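/- Let $G$ be a word hyperbolic group, i.e. a group having a finite generating set $S$ and a constant $\delta\ge 0$ such that, in the Cayley graph of $G$ with respect to $S$, each side of every geodesic triangle with vertices in $G$ lies in the $\delta$-neighbourhood of the union of the other two sides. Let $H$ be an infinite quasi-convex subgroup of $G$, i.e. an infinite subgroup for which there are a finite generating set $S'$ of $G$ and a constant $K\ge 0$ such that every geodesic with endpoints in $H$ in the Cayley graph of $G$ with respect to $S'$ lies in the $K$-neighbourhood of $H$. Then $H$ has finite index in its commensurator $$\mathrm{Comm}(H,G)=\{g\in G : gHg^{-1}\cap H \text{ has finite index in both } gHg^{-1} \text{ and } H\},$$ which is a subgroup of $G$ containing $H$. -/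

import Mathlib

/-- A walk in a graph is geodesic if it is a shortest edge path between its endpoints. -/
def SimpleGraph.Walk.IsGeodesicPath {V : Type*} {Γ : SimpleGraph V} {u v : V}
    (p : Γ.Walk u v) : Prop :=
  p.length = Γ.dist u v

/-- Geodesic triangles of `Γ` (with vertices at vertices of `Γ`) are `δ`-thin: each side lies in
the `δ`-neighbourhood of the union of the other two. The bound is stated for one side of the
triangle; by symmetry in `x`, `y`, `z` it holds for each of them. -/
def SimpleGraph.HasThinTriangles {V : Type*} (Γ : SimpleGraph V) (δ : ℕ) : Prop :=
  ∀ (x y z : V) (p : Γ.Walk x y) (q : Γ.Walk y z) (r : Γ.Walk x z),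
    p.IsGeodesicPath → q.IsGeodesicPath → r.IsGeodesicPath →
      ∀ a ∈ p.support, ∃ b, (b ∈ q.support ∨ b ∈ r.support) ∧ Γ.dist a b ≤ δ

/-- `G` is word hyperbolic: geodesic triangles in the Cayley graph of `G` with respect to some
finite generating set are uniformly thin. -/
def IsWordHyperbolic (G : Type*) [Group G] : Prop :=
  ∃ S : Set G, S.Finite ∧ Subgroup.closure S = ⊤ ∧
    ∃ δ : ℕ, (SimpleGraph.mulCayley S).HasThinTriangles δ

/-- `H` is quasi-convex in `G`: for some finite generating set of `G`, there is a constant `K` such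
that each geodesic of the Cayley graph joining two elements of `H` lies in the `K`-neighbourhood
of `H`. The generating set need not be the one that witnesses hyperbolicity of `G`. -/
def Subgroup.IsQuasiconvex {G : Type*} [Group G] (H : Subgroup G) : Prop :=
  ∃ S : Set G, S.Finite ∧ Subgroup.closure S = ⊤ ∧
    ∃ K : ℕ, ∀ x ∈ H, ∀ y ∈ H, ∀ p : (SimpleGraph.mulCayley S).Walk x y, p.IsGeodesicPath →
      ∀ a ∈ p.support, ∃ h ∈ H, (SimpleGraph.mulCayley S).dist a h ≤ K

/-! If `g` commensurates `H`, then `H` lies within some distance `D` of `gH`. Since `H` is infinite,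
it contains a `y` far from `1`; in the quadrilateral spanned by `1`, `y` and nearby points of `gH`,
a point deep inside the side from `1` to `y` must be `2δ`-close to the opposite side.
Quasi-convexity puts these two points within `K` of `H` and of `gH`, so `HgH` meets the ball of
radius `2K + 2δ`, a bound free of `D` (`Subgroup.exists_bound_commensurator`). Balls are finite, and
a double coset of a commensurating element is finitely many left cosets, so the commensurator is a
finite union of cosets of `H`. Hyperbolicity and quasi-convexity may use different generating sets;
stability of quasi-geodesics (`HasThinTriangles.exists_bound_of_quasigeodesic`) reconciles them. -/

namespace SimpleGraph

variable {V : Type*} {Γ : SimpleGraph V}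

/-! ### Points on geodesics. -/

/-- The vertex `a` lies on some geodesic from `x` to `y`. -/
def IsBetween (Γ : SimpleGraph V) (x a y : V) : Prop :=
  Γ.dist x a + Γ.dist a y = Γ.dist x y

theorem IsBetween.symm {x a y : V} (h : Γ.IsBetween x a y) : Γ.IsBetween y a x := by
  unfold IsBetween at *
  rw [Γ.dist_comm (u := y) (v := a), Γ.dist_comm (u := a) (v := x), Γ.dist_comm (u := y) (v := x)]
  omega

theorem Walk.dist_getVert_le {x y : V} (hΓ : Γ.Connected) (p : Γ.Walk x y) {i j : ℕ}
    (hij : i ≤ j) (hj : j ≤ p.length) : Γ.dist (p.getVert i) (p.getVert j) ≤ j - i := by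
  induction j, hij using Nat.le_induction with
  | base => simp
  | succ j hij ih =>
    have h₁ := ih (by omega)
    have h₂ := dist_eq_one_iff_adj.2 (p.adj_getVert_succ (i := j) (by omega))
    have h₃ := hΓ.dist_triangle (u := p.getVert i) (v := p.getVert j) (w := p.getVert (j + 1))
    omega

theorem Walk.IsGeodesicPath.dist_getVert {x y : V} (hΓ : Γ.Connected) {p : Γ.Walk x y}
    (hp : p.IsGeodesicPath) {i j : ℕ} (hij : i ≤ j) (hj : j ≤ p.length) :
    Γ.dist (p.getVert i) (p.getVert j) = j - i := by
  have h₁ := p.dist_getVert_le hΓ (Nat.zero_le i) (hij.trans hj)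
  have h₂ := p.dist_getVert_le hΓ hij hj
  have h₃ := p.dist_getVert_le hΓ hj le_rfl
  have h₄ := hΓ.dist_triangle (u := x) (v := p.getVert i) (w := p.getVert j)
  have h₅ := hΓ.dist_triangle (u := x) (v := p.getVert j) (w := y)
  unfold Walk.IsGeodesicPath at hp
  simp only [Walk.getVert_zero, Walk.getVert_length] at h₁ h₃
  omega

theorem Walk.IsGeodesicPath.isBetween {x y a : V} (hΓ : Γ.Connected) {p : Γ.Walk x y}
    (hp : p.IsGeodesicPath) (ha : a ∈ p.support) : Γ.IsBetween x a y := by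
  obtain ⟨i, rfl, hi⟩ := Walk.mem_support_iff_exists_getVert.1 ha
  have h₁ := hp.dist_getVert hΓ (Nat.zero_le i) hi
  have h₂ := hp.dist_getVert hΓ hi le_rfl
  unfold Walk.IsGeodesicPath at hp
  simp only [Walk.getVert_zero, Walk.getVert_length] at h₁ h₂
  unfold IsBetween
  omega

theorem IsBetween.exists_geodesic {x a y : V} (hΓ : Γ.Connected) (h : Γ.IsBetween x a y) :
    ∃ p : Γ.Walk x y, p.IsGeodesicPath ∧ a ∈ p.support := by
  obtain ⟨p, hp⟩ := hΓ.exists_walk_length_eq_dist x a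
  obtain ⟨q, hq⟩ := hΓ.exists_walk_length_eq_dist a y
  refine ⟨p.append q, ?_, by simp⟩
  unfold Walk.IsGeodesicPath
  rw [Walk.length_append, hp, hq, h]

theorem Connected.exists_isBetween_dist_eq (hΓ : Γ.Connected) (x y : V) {k : ℕ}
    (hk : k ≤ Γ.dist x y) : ∃ a, Γ.IsBetween x a y ∧ Γ.dist x a = k := by
  obtain ⟨p, hp⟩ := hΓ.exists_walk_length_eq_dist x y
  have hg : p.IsGeodesicPath := hp
  refine ⟨p.getVert k, hg.isBetween hΓ (p.getVert_mem_support k), ?_⟩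
  simpa using hg.dist_getVert hΓ (Nat.zero_le k) (by omega)

theorem IsBetween.trans_left {x u a y : V} (hΓ : Γ.Connected) (ha : Γ.IsBetween x a y)
    (hu : Γ.IsBetween x u a) : Γ.IsBetween x u y := by
  have h₁ := hΓ.dist_triangle (u := u) (v := a) (w := y)
  have h₂ := hΓ.dist_triangle (u := x) (v := u) (w := y)
  unfold IsBetween at *
  omega

theorem IsBetween.of_trans_left {x u a y : V} (hΓ : Γ.Connected) (ha : Γ.IsBetween x a y)
    (hu : Γ.IsBetween x u a) : Γ.IsBetween u a y := by
  have h₁ := hΓ.dist_triangle (u := u) (v := a) (w := y)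
  have h₂ := hΓ.dist_triangle (u := x) (v := u) (w := y)
  unfold IsBetween at *
  omega

/-! ### Thin polygons and stability of quasi-geodesics. -/

theorem HasThinTriangles.exists_dist_le {δ : ℕ} (hδ : Γ.HasThinTriangles δ) (hΓ : Γ.Connected)
    {x y a : V} (z : V) (ha : Γ.IsBetween x a y) :
    ∃ b, (Γ.IsBetween y b z ∨ Γ.IsBetween x b z) ∧ Γ.dist a b ≤ δ := by
  obtain ⟨p, hp, hap⟩ := ha.exists_geodesic hΓ
  obtain ⟨q, hq⟩ := hΓ.exists_walk_length_eq_dist y z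
  obtain ⟨r, hr⟩ := hΓ.exists_walk_length_eq_dist x z
  obtain ⟨b, hb, hab⟩ := hδ x y z p q r hp hq hr a hap
  exact ⟨b, hb.imp (Walk.IsGeodesicPath.isBetween hΓ hq) (Walk.IsGeodesicPath.isBetween hΓ hr), hab⟩

/-- Geodesic quadrilaterals are `2δ`-thin. -/
theorem HasThinTriangles.exists_dist_le_quadrilateral {δ : ℕ} (hδ : Γ.HasThinTriangles δ)
    (hΓ : Γ.Connected) {x y a : V} (z w : V) (ha : Γ.IsBetween x a y) :
    ∃ b, (Γ.IsBetween y b z ∨ Γ.IsBetween z b w ∨ Γ.IsBetween x b w) ∧ Γ.dist a b ≤ 2 * δ := by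
  obtain ⟨b, hb | hb, hab⟩ := hδ.exists_dist_le hΓ z ha
  · exact ⟨b, Or.inl hb, by omega⟩
  · obtain ⟨b', hb', hbb'⟩ := hδ.exists_dist_le hΓ w hb
    have := hΓ.dist_triangle (u := a) (v := b) (w := b')
    exact ⟨b', Or.inr hb', by omega⟩

/-- A geodesic stays logarithmically close to any discrete path with the same endpoints. -/
theorem HasThinTriangles.exists_dist_le_of_path {δ : ℕ} (hδ : Γ.HasThinTriangles δ)
    (hΓ : Γ.Connected) {L : ℕ} {c : ℕ → V} {n : ℕ}
    (hc : ∀ i < n, Γ.dist (c i) (c (i + 1)) ≤ L) (k : ℕ) :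
    ∀ i j, i ≤ j → j ≤ n → j - i ≤ 2 ^ k → ∀ a, Γ.IsBetween (c i) a (c j) →
      ∃ m ≤ n, Γ.dist a (c m) ≤ δ * k + L := by
  induction k with
  | zero =>
    intro i j hij hj hk a ha
    refine ⟨i, hij.trans hj, ?_⟩
    have hd : Γ.dist (c i) (c j) ≤ L := by
      rcases hij.eq_or_lt with rfl | hlt
      · simp
      · obtain rfl : j = i + 1 := by simp at hk; omega
        exact hc i (by omega)
    rw [Γ.dist_comm]
    unfold IsBetween at ha
    omega
  | succ k ih =>
    intro i j hij hj hk a ha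
    rw [pow_succ] at hk
    -- Bisecting the path costs one thin triangle, hence one `δ`, per halving.
    set l := (i + j) / 2 with hl
    obtain ⟨b, hb, hab⟩ := hδ.exists_dist_le hΓ (c l) ha
    obtain ⟨m, hm, hbm⟩ : ∃ m ≤ n, Γ.dist b (c m) ≤ δ * k + L := by
      rcases hb with hb | hb
      · exact ih l j (by omega) hj (by omega) b hb.symm
      · exact ih i l (by omega) (by omega) (by omega) b hb
    have := hΓ.dist_triangle (u := a) (v := b) (w := c m)
    exact ⟨m, hm, by rw [mul_add]; omega⟩

theorem exists_forall_mul_succ_le_two_pow (A : ℕ) : ∃ q₀, ∀ q ≥ q₀, A * (q + 1) ≤ 2 ^ q := by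
  refine ⟨2 * A + 2, fun q hq => ?_⟩
  induction q, hq using Nat.le_induction with
  | base =>
    have h : A < 2 ^ A := Nat.lt_two_pow_self
    have : 2 ^ (2 * A + 2) = 4 * (2 ^ A * 2 ^ A) := by ring
    nlinarith
  | succ q hq ih =>
    rw [pow_succ]
    nlinarith

/-- Taking `k` about `D / (2δ + 2)` keeps `δ * k` below `D / 2` while `2 ^ k` outgrows every linear
function of `D`. This makes a logarithmic distance bound contradict a large gap `D`. -/
theorem exists_forall_gt_exists_two_pow (δ B A : ℕ) :
    ∃ R, ∀ D > R, ∃ k, A * D ≤ 2 ^ k ∧ B + δ * k < D := by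
  obtain ⟨q₀, hq₀⟩ := exists_forall_mul_succ_le_two_pow (A * (2 * δ + 2))
  refine ⟨2 * B + (2 * δ + 2) * q₀, fun D hD => ⟨D / (2 * δ + 2), ?_, ?_⟩⟩
  · have hq : q₀ ≤ D / (2 * δ + 2) := by
      rw [Nat.le_div_iff_mul_le (by omega), mul_comm]
      omega
    refine le_trans ?_ (hq₀ _ hq)
    rw [mul_assoc]
    exact Nat.mul_le_mul_left A (Nat.lt_mul_div_succ D (by omega)).le
  · have h₁ := Nat.mul_div_le D (2 * δ + 2)
    have h₂ : (2 * δ + 2) * (D / (2 * δ + 2)) =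
        2 * (δ * (D / (2 * δ + 2))) + 2 * (D / (2 * δ + 2)) := by ring
    omega

/-- A geodesic stays uniformly close to any discrete quasi-geodesic with the same endpoints. -/
theorem HasThinTriangles.exists_bound_of_quasigeodesic {δ : ℕ} (hδ : Γ.HasThinTriangles δ)
    (hΓ : Γ.Connected) (L M : ℕ) :
    ∃ R, ∀ (c : ℕ → V) (n : ℕ), (∀ i < n, Γ.dist (c i) (c (i + 1)) ≤ L) →
      (∀ i j, i ≤ j → j ≤ n → j - i ≤ M * Γ.dist (c i) (c j)) →
      ∀ a, Γ.IsBetween (c 0) a (c n) → ∃ i ≤ n, Γ.dist a (c i) ≤ R := by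
  obtain ⟨R, hR⟩ := exists_forall_gt_exists_two_pow δ (2 * δ + L) (M * 6)
  refine ⟨R, fun c n hL hM a₀ ha₀ => ?_⟩
  by_contra! hfar
  -- Choose `p` on a geodesic at the largest possible distance `D` from the path.
  let P : ℕ → Prop := fun D => ∃ a, Γ.IsBetween (c 0) a (c n) ∧ ∀ i ≤ n, D ≤ Γ.dist a (c i)
  have hbdd : ∀ D, P D → D ≤ Γ.dist (c 0) (c n) := by
    rintro D ⟨a, ha, hD⟩
    have := hD n le_rfl
    unfold IsBetween at ha
    omega
  classical
  have hPR : P (R + 1) := ⟨a₀, ha₀, hfar⟩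
  obtain ⟨p, hp, hpD⟩ := Nat.findGreatest_spec (hbdd _ hPR) hPR
  have hRD : R + 1 ≤ _ := Nat.le_findGreatest (hbdd _ hPR) hPR
  set D := Nat.findGreatest P (Γ.dist (c 0) (c n)) with hDdef
  have hclose : ∀ u, Γ.IsBetween (c 0) u (c n) → ∃ i ≤ n, Γ.dist u (c i) ≤ D := by
    intro u hu
    by_contra! h
    have h' : P (D + 1) := ⟨u, hu, h⟩
    have := Nat.le_findGreatest (hbdd _ h') h'
    omega
  -- Go back `2D` from `p` towards an end, or to the end itself if it is nearer. A connector of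
  -- length at most `D` from there to the path stays at distance at least `D` from `p`.
  have hside : ∀ e ≤ n, (∀ u, Γ.IsBetween (c e) u p → Γ.IsBetween (c 0) u (c n)) →
      ∃ u, Γ.IsBetween (c e) u p ∧ Γ.dist u p ≤ 2 * D ∧ ∃ i ≤ n, Γ.dist u (c i) ≤ D ∧
        ∀ w, Γ.IsBetween u w (c i) → D ≤ Γ.dist p w := by
    intro e he hsub
    rcases le_or_gt (Γ.dist (c e) p) (2 * D) with hle | hgt
    · refine ⟨c e, by simp [IsBetween], hle, e, he, by simp, fun w hw => ?_⟩
      have hw' : Γ.dist (c e) w = 0 := by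
        unfold IsBetween at hw
        rw [Γ.dist_self] at hw
        omega
      rw [← hΓ.dist_eq_zero_iff.1 hw']
      exact hpD e he
    · obtain ⟨u, hu, hud⟩ := hΓ.exists_isBetween_dist_eq (c e) p (k := Γ.dist (c e) p - 2 * D)
        (by omega)
      obtain ⟨i, hi, hui⟩ := hclose u (hsub u hu)
      have hup : Γ.dist u p = 2 * D := by
        unfold IsBetween at hu
        omega
      refine ⟨u, hu, hup.le, i, hi, hui, fun w hw => ?_⟩
      have h₁ := hΓ.dist_triangle (u := u) (v := w) (w := p)
      rw [Γ.dist_comm (u := w) (v := p)] at h₁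
      unfold IsBetween at hw
      omega
  obtain ⟨u, hu, hup, i, hi, hui, huw⟩ := hside 0 (Nat.zero_le n) fun u hu => hp.trans_left hΓ hu
  obtain ⟨v, hv, hvp, j, hj, hvj, hvw⟩ :=
    hside n le_rfl fun u hu => (hp.symm.trans_left hΓ hu).symm
  have hupv : Γ.IsBetween u p v :=
    ((hp.of_trans_left hΓ hu).symm.of_trans_left hΓ hv).symm
  obtain ⟨k, hk, hkD⟩ := hR D (by omega)
  -- `6D = D + 2D + 2D + D`, along `c i`, `u`, `p`, `v`, `c j`.
  have hij : Γ.dist (c i) (c j) ≤ 6 * D := by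
    have h₁ := hΓ.dist_triangle (u := c i) (v := u) (w := c j)
    have h₂ := hΓ.dist_triangle (u := u) (v := p) (w := c j)
    have h₃ := hΓ.dist_triangle (u := p) (v := v) (w := c j)
    rw [Γ.dist_comm (u := c i) (v := u)] at h₁
    rw [Γ.dist_comm (u := p) (v := v)] at h₃
    omega
  have hMD : M * Γ.dist (c i) (c j) ≤ 2 ^ k :=
    (Nat.mul_le_mul_left M hij).trans (by rwa [← mul_assoc])
  -- As `D > 2δ`, the point `b` is on neither connector, so it lies between `c i` and `c j`, where
  -- the path has at most `2 ^ k` steps.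
  obtain ⟨b, hb, hpb⟩ := hδ.exists_dist_le_quadrilateral hΓ (c j) (c i) hupv
  obtain ⟨m, hm, hbm⟩ : ∃ m ≤ n, Γ.dist b (c m) ≤ δ * k + L := by
    rcases hb with hb | hb | hb
    · have := hvw b hb
      omega
    · rcases le_total i j with h | h
      · exact hδ.exists_dist_le_of_path hΓ hL k i j h hj ((hM i j h hj).trans hMD) b hb.symm
      · rw [Γ.dist_comm] at hMD
        exact hδ.exists_dist_le_of_path hΓ hL k j i h hi ((hM j i h hi).trans hMD) b hb
    · have := huw b hb
      omega
  have h₁ := hpD m hm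
  have h₂ := hΓ.dist_triangle (u := p) (v := b) (w := c m)
  omega

/-! ### Word metrics: comparison, left invariance, finite balls. -/

theorem Connected.dist_le_mul_dist {Γ' : SimpleGraph V} (hΓ : Γ.Connected) (hΓ' : Γ'.Connected)
    {L : ℕ} (hL : ∀ x y, Γ'.Adj x y → Γ.dist x y ≤ L) (x y : V) :
    Γ.dist x y ≤ L * Γ'.dist x y := by
  obtain ⟨p, hp⟩ := hΓ'.exists_walk_length_eq_dist x y
  rw [← hp]
  clear hp
  induction p with
  | nil => simp
  | cons h p ih =>
    refine hΓ.dist_triangle.trans ((add_le_add (hL _ _ h) ih).trans ?_)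
    rw [Walk.length_cons]
    exact le_of_eq (by ring)

section Cayley

variable {G : Type*} [Group G] {S : Set G}

theorem mulCayley_dist_mul_left_le (hS : (mulCayley S).Connected) (g x y : G) :
    (mulCayley S).dist (g * x) (g * y) ≤ (mulCayley S).dist x y := by
  obtain ⟨p, hp⟩ := hS.exists_walk_length_eq_dist x y
  let f : mulCayley S →g mulCayley S := ⟨fun z => g * z, fun h => mulCayley_adj_mul_iff_right.2 h⟩
  have := dist_le (p.map f)
  rw [Walk.length_map, hp] at this
  exact this

theorem mulCayley_dist_mul_left (hS : (mulCayley S).Connected) (g x y : G) :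
    (mulCayley S).dist (g * x) (g * y) = (mulCayley S).dist x y := by
  refine le_antisymm (mulCayley_dist_mul_left_le hS g x y) ?_
  simpa using mulCayley_dist_mul_left_le hS g⁻¹ (g * x) (g * y)

theorem mulCayley_reachable_mul_left {x y : G} (g : G) (h : (mulCayley S).Reachable x y) :
    (mulCayley S).Reachable (g * x) (g * y) := by
  let f : mulCayley S →g mulCayley S := ⟨fun z => g * z, fun h => mulCayley_adj_mul_iff_right.2 h⟩
  exact h.map f

theorem mulCayley_connected (hS : Subgroup.closure S = ⊤) : (mulCayley S).Connected := by
  have h1 : ∀ g : G, (mulCayley S).Reachable 1 g := by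
    intro g
    have hg : g ∈ Subgroup.closure S := hS ▸ Subgroup.mem_top g
    induction hg using Subgroup.closure_induction with
    | mem s hs =>
      by_cases h : (1 : G) = s
      · rw [h]
      · exact Adj.reachable ((mulCayley_adj S 1 s).2 ⟨h, Or.inl (by simpa using hs)⟩)
    | one => exact Reachable.refl _
    | mul x y _ _ hx hy => exact hx.trans (by simpa using mulCayley_reachable_mul_left x hy)
    | inv x _ hx => simpa using (mulCayley_reachable_mul_left x⁻¹ hx).symm
  exact connected_iff _ |>.2 ⟨fun x y => (h1 x).symm.trans (h1 y), ⟨1⟩⟩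

theorem mulCayley_finite_ball (hfin : S.Finite) (hS : (mulCayley S).Connected) (n : ℕ) :
    {g : G | (mulCayley S).dist 1 g ≤ n}.Finite := by
  induction n with
  | zero =>
    refine (Set.finite_singleton (1 : G)).subset fun g hg => ?_
    exact (hS.dist_eq_zero_iff.1 (Nat.le_zero.1 hg)).symm
  | succ n ih =>
    have hT : (S ∪ S⁻¹).Finite := hfin.union hfin.inv
    refine ((ih.mul hT).union ih).subset fun g hg => ?_
    rcases Nat.lt_or_ge n ((mulCayley S).dist 1 g) with h | h
    · obtain ⟨a, ha, had⟩ := hS.exists_isBetween_dist_eq 1 g h.le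
      have hag : (mulCayley S).Adj a g := by
        rw [← dist_eq_one_iff_adj]
        have : (mulCayley S).dist 1 g ≤ n + 1 := hg
        unfold IsBetween at ha
        omega
      refine Or.inl ⟨a, had.le, a⁻¹ * g, ?_, by simp⟩
      exact ((mulCayley_adj S a g).1 hag).2.imp id (fun h => by simpa using h)
    · exact Or.inr h

theorem mulCayley_exists_dist_le_mul {S' : Set G} (hS : (mulCayley S).Connected)
    (hfin' : S'.Finite) (hS' : (mulCayley S').Connected) :
    ∃ L, ∀ x y, (mulCayley S).dist x y ≤ L * (mulCayley S').dist x y := by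
  obtain ⟨L, hL⟩ := (hfin'.image fun s => (mulCayley S).dist 1 s).bddAbove
  refine ⟨L, fun x y => hS.dist_le_mul_dist hS' (fun x y hxy => ?_) x y⟩
  have key : ∀ x y : G, x⁻¹ * y ∈ S' → (mulCayley S).dist x y ≤ L := fun x y h => by
    have := mulCayley_dist_mul_left hS x⁻¹ x y
    rw [inv_mul_cancel] at this
    rw [← this]
    exact hL ⟨_, h, rfl⟩
  rcases ((mulCayley_adj S' x y).1 hxy).2 with h | h
  · exact key x y h
  · rw [dist_comm]
    exact key y x h

end Cayley

end SimpleGraph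

open SimpleGraph
open scoped Pointwise

/-! ### Quasi-convex subgroups and their commensurators. -/

section Commensurator

variable {G : Type*} [Group G]

/-- Quasi-convexity does not depend on the finite generating set of a hyperbolic group. -/
theorem Subgroup.IsQuasiconvex.exists_bound_of_hasThinTriangles {H : Subgroup G}
    (hH : H.IsQuasiconvex) {S : Set G} (hfin : S.Finite) (hS : (mulCayley S).Connected) {δ : ℕ}
    (hδ : (mulCayley S).HasThinTriangles δ) :
    ∃ K, ∀ x ∈ H, ∀ y ∈ H, ∀ a, (mulCayley S).IsBetween x a y →
      ∃ h ∈ H, (mulCayley S).dist a h ≤ K := by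
  obtain ⟨S', hfin', hgen', K, hK⟩ := hH
  have hS' := mulCayley_connected hgen'
  obtain ⟨L, hL⟩ := mulCayley_exists_dist_le_mul hS hfin' hS'
  obtain ⟨M, hM⟩ := mulCayley_exists_dist_le_mul hS' hfin hS
  obtain ⟨R, hR⟩ := hδ.exists_bound_of_quasigeodesic hS L M
  refine ⟨R + L * K, fun x hx y hy a ha => ?_⟩
  obtain ⟨p, hp⟩ := hS'.exists_walk_length_eq_dist x y
  have hg : p.IsGeodesicPath := hp
  -- An `S'`-geodesic is a quasi-geodesic for `S`.
  obtain ⟨i, -, hai⟩ := hR p.getVert p.length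
    (fun i hi => (hL _ _).trans (by rw [dist_eq_one_iff_adj.2 (p.adj_getVert_succ hi), mul_one]))
    (fun i j hij hj => by rw [← hg.dist_getVert hS' hij hj]; exact hM _ _) a (by simpa using ha)
  obtain ⟨h, hh, hd⟩ := hK x hx y hy p hg _ (p.getVert_mem_support i)
  refine ⟨h, hh, hS.dist_triangle.trans (add_le_add hai ((hL _ _).trans ?_))⟩
  exact Nat.mul_le_mul_left L hd

/-- If `g` commensurates `H`, then `H` is covered by finitely many right cosets of
`gHg⁻¹ ∩ H`. -/
theorem Subgroup.exists_finite_cover_of_mem_commensurator {H : Subgroup G} {g : G}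
    (hg : g ∈ Subgroup.Commensurable.commensurator H) :
    ∃ T : Set G, T.Finite ∧ ∀ h ∈ H, ∃ t ∈ T, ∃ k ∈ H, h = g * k * g⁻¹ * t := by
  have hne := ((Subgroup.Commensurable.commensurator_mem_iff H g).1 hg).1
  set N := (ConjAct.toConjAct g • H).subgroupOf H
  have : N.FiniteIndex := ⟨hne⟩
  -- Inversion turns left coset representatives into right ones.
  refine ⟨Set.range fun q : H ⧸ N => ((q.out : H) : G)⁻¹, Set.finite_range _, fun h hh => ?_⟩
  let q : H ⧸ N := QuotientGroup.mk (⟨h, hh⟩⁻¹ : H)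
  have hq : (QuotientGroup.mk (⟨h, hh⟩⁻¹ : H) : H ⧸ N) = QuotientGroup.mk q.out :=
    (QuotientGroup.out_eq' q).symm
  have hmem := Subgroup.mem_subgroupOf.1 (QuotientGroup.eq.1 hq)
  rw [Subgroup.mem_smul_pointwise_iff_exists] at hmem
  obtain ⟨k, hk, hkeq⟩ := hmem
  rw [ConjAct.smul_def, ConjAct.ofConjAct_toConjAct] at hkeq
  refine ⟨_, ⟨q, rfl⟩, k, hk, ?_⟩
  rw [hkeq]
  simp

/-- If `b` commensurates `H`, the double coset `HbH` is a finite union of left cosets of `H`. -/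
theorem Subgroup.finite_mk_mul_of_mem_commensurator {H : Subgroup G} {b : G}
    (hb : b ∈ Subgroup.Commensurable.commensurator H) :
    {q : G ⧸ H | ∃ h ∈ H, q = QuotientGroup.mk (h * b)}.Finite := by
  obtain ⟨T, hT, hcov⟩ := Subgroup.exists_finite_cover_of_mem_commensurator hb
  refine (hT.image fun t => (QuotientGroup.mk (t⁻¹ * b) : G ⧸ H)).subset ?_
  rintro _ ⟨h, hh, rfl⟩
  obtain ⟨t, ht, k, hk, hkt⟩ := hcov h⁻¹ (H.inv_mem hh)
  refine ⟨t, ht, ?_⟩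
  rw [QuotientGroup.eq, show h = (b * k * b⁻¹ * t)⁻¹ by rw [← hkt, inv_inv]]
  simpa [mul_assoc] using hk

theorem Subgroup.le_commensurator (H : Subgroup G) :
    H ≤ Subgroup.Commensurable.commensurator H := by
  intro h hh
  have hconj : ConjAct.toConjAct h • H = H := Subgroup.conj_smul_eq_self_of_mem hh
  rw [Subgroup.Commensurable.commensurator_mem_iff, hconj]

/-- In a hyperbolic group, every element of the commensurator of an infinite quasi-convex subgroup
`H` lies in `HbH` for some `b` of uniformly bounded length. -/
theorem Subgroup.exists_bound_commensurator {H : Subgroup G} (hinf : Infinite H) {S : Set G}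
    (hfin : S.Finite) (hS : (mulCayley S).Connected) {δ K : ℕ}
    (hδ : (mulCayley S).HasThinTriangles δ)
    (hK : ∀ x ∈ H, ∀ y ∈ H, ∀ a, (mulCayley S).IsBetween x a y →
      ∃ h ∈ H, (mulCayley S).dist a h ≤ K)
    {g : G} (hg : g ∈ Subgroup.Commensurable.commensurator H) :
    ∃ h ∈ H, ∃ h' ∈ H, (mulCayley S).dist 1 (h * g * h') ≤ 2 * K + 2 * δ := by
  set d := (mulCayley S).dist with hd
  have hinv : ∀ g x y, d (g * x) (g * y) = d x y := mulCayley_dist_mul_left hS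
  obtain ⟨T, hT, hcov⟩ := Subgroup.exists_finite_cover_of_mem_commensurator hg
  obtain ⟨D, hD⟩ := (hT.image fun t => d t g).bddAbove
  have hnear : ∀ h ∈ H, ∃ k ∈ H, d h (g * k) ≤ D := by
    intro h hh
    obtain ⟨t, ht, k, hk, rfl⟩ := hcov h hh
    refine ⟨k, hk, ?_⟩
    have := hinv (g * k * g⁻¹) t g
    rw [show g * k * g⁻¹ * g = g * k by group] at this
    rw [this]
    exact hD ⟨t, ht, rfl⟩
  obtain ⟨y, hy, hfar⟩ : ∃ y ∈ H, 2 * (D + 2 * δ + 1) < d 1 y := by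
    by_contra! h
    exact (Set.infinite_coe_iff.1 hinf) ((mulCayley_finite_ball hfin hS _).subset h)
  -- Both ends are more than `D + 2δ` from `a`, so the two short sides, of length at most `D`, stay
  -- more than `2δ` away from it.
  obtain ⟨a, ha, had⟩ := hS.exists_isBetween_dist_eq 1 y (k := D + 2 * δ + 1) (by
    rw [← hd]; omega)
  obtain ⟨k₁, hk₁, hd₁⟩ := hnear 1 H.one_mem
  obtain ⟨k₂, hk₂, hd₂⟩ := hnear y hy
  obtain ⟨b, hb, hab⟩ := hδ.exists_dist_le_quadrilateral hS (g * k₂) (g * k₁) ha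
  have h₁ : d 1 a ≤ d 1 b + d b a := hS.dist_triangle
  have h₂ : d a y ≤ d a b + d b y := hS.dist_triangle
  have c₁ : d b a = d a b := (mulCayley S).dist_comm
  have c₂ : d b y = d y b := (mulCayley S).dist_comm
  have hay : d 1 a + d a y = d 1 y := ha
  rw [← hd] at had hab
  have hb' : (mulCayley S).IsBetween (g * k₂) b (g * k₁) := by
    rcases hb with hb | hb | hb
    · have hb : d y b + d b (g * k₂) = d y (g * k₂) := hb
      omega
    · exact hb
    · have hb : d 1 b + d b (g * k₁) = d 1 (g * k₁) := hb
      omega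
  -- Translating by `g⁻¹` gives a geodesic with endpoints in `H`.
  have hb'' : (mulCayley S).IsBetween k₂ (g⁻¹ * b) k₁ := by
    unfold IsBetween at hb' ⊢
    rw [← hd] at hb' ⊢
    rw [← hinv g k₂, ← hinv g _ k₁, ← hinv g k₂ k₁, mul_inv_cancel_left]
    exact hb'
  obtain ⟨h, hh, hah⟩ := hK 1 H.one_mem y hy a ha
  obtain ⟨h', hh', hbh'⟩ := hK k₂ hk₂ k₁ hk₁ _ hb''
  refine ⟨h⁻¹, H.inv_mem hh, h', hh', ?_⟩
  rw [← hinv g, mul_inv_cancel_left] at hbh'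
  rw [← hinv h, mul_one, show h * (h⁻¹ * g * h') = g * h' by group]
  have h₃ : d h (g * h') ≤ d h a + d a (g * h') := hS.dist_triangle
  have h₄ : d a (g * h') ≤ d a b + d b (g * h') := hS.dist_triangle
  have c₃ : d h a = d a h := (mulCayley S).dist_comm
  omega

end Commensurator

theorem theorem16 {G : Type*} [Group G] (hG : IsWordHyperbolic G)
    (H : Subgroup G) (hinf : Infinite H) (hH : H.IsQuasiconvex) :
    H ≤ Subgroup.Commensurable.commensurator H ∧
      (H.subgroupOf (Subgroup.Commensurable.commensurator H)).FiniteIndex := by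
  refine ⟨H.le_commensurator, ?_⟩
  obtain ⟨S, hfin, hgen, δ, hδ⟩ := hG
  have hS := mulCayley_connected hgen
  obtain ⟨K, hK⟩ := hH.exists_bound_of_hasThinTriangles hfin hS hδ
  set C := Subgroup.Commensurable.commensurator H with hC
  have hB : {b : G | (mulCayley S).dist 1 b ≤ 2 * K + 2 * δ ∧ b ∈ C}.Finite :=
    (mulCayley_finite_ball hfin hS _).subset fun b hb => hb.1
  have hF := hB.biUnion fun b hb => Subgroup.finite_mk_mul_of_mem_commensurator (hC ▸ hb.2)
  have hmem : ∀ g ∈ C, (QuotientGroup.mk g : G ⧸ H) ∈ (⋃ b ∈ {b : G |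
      (mulCayley S).dist 1 b ≤ 2 * K + 2 * δ ∧ b ∈ C},
      {q : G ⧸ H | ∃ h ∈ H, q = QuotientGroup.mk (h * b)}) := by
    intro g hg
    obtain ⟨h, hh, h', hh', hd⟩ := Subgroup.exists_bound_commensurator hinf hfin hS hδ hK hg
    have hbC : h * g * h' ∈ C :=
      C.mul_mem (C.mul_mem (H.le_commensurator hh) hg) (H.le_commensurator hh')
    refine Set.mem_biUnion (⟨hd, hbC⟩ : h * g * h' ∈ {b : G | _ ∧ b ∈ C})
      ⟨h⁻¹, H.inv_mem hh, ?_⟩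
    rw [QuotientGroup.eq]
    simpa [mul_assoc] using hh'
  have := hF.to_subtype
  have : Finite (C ⧸ H.subgroupOf C) := by
    refine Finite.of_injective (β := ↥(⋃ b ∈ {b : G |
      (mulCayley S).dist 1 b ≤ 2 * K + 2 * δ ∧ b ∈ C},
      {q : G ⧸ H | ∃ h ∈ H, q = QuotientGroup.mk (h * b)}))
      -- The cosets of `H` in `C` embed into the finite set of cosets in `G` found above.
      (fun q => ⟨QuotientGroup.mk (q.out : G), hmem _ q.out.2⟩) fun q r hqr => ?_
    have h := QuotientGroup.eq.1 (Subtype.ext_iff.1 hqr)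
    rw [← QuotientGroup.out_eq' q, ← QuotientGroup.out_eq' r, QuotientGroup.eq,
      Subgroup.mem_subgroupOf]
    simpa using h
  exact Subgroup.finiteIndex_of_finite_quotient
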